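/- Let $H$ be a separable complex Hilbert space, let $\mathcal B(H)$ be the C*-algebra of bounded linear operators on $H$, let $X$ be a compact Hausdorff space, and let $C(X,\mathcal B(H))$ be the C*-algebra of norm-continuous functions $X\to\mathcal B(H)$. Let $\phi: C(X,\mathcal B(H))\to C(X,\mathcal B(H))$ be an order automorphism, that is, a linear bijection such that, for every $f$, $\phi(f)$ is positive if and only if $f$ is positive. Let $\operatorname{Jaut}(\mathcal B(H))$ be the group of Jordan *-automorphisms of $\mathcal B(H)$, that is, of linear bijections $\theta:\mathcal B(H)\to\mathcal B(H)$ with $\theta(A^2)=\theta(A)^2$ and $\theta(A^*)=\theta(A)^*$ for all $A$. Then there exist - a function $b\in C(X,\mathcal B(H))$ all of whose values are invertible positive operators, - a map $\tau: X\to\operatorname{Jaut}(\mathcal B(H))$ such that $x\mapsto\tau(x)$ and $x\mapsto\tau(x)^{-1}$ are strongly continuous, i.e. for every $A\in\mathcal B(H)$ the maps $x\mapsto\tau(x)(A)$ and $x\mapsto\tau(x)^{-1}(A)$ are norm-continuous on $X$, - a homeomorphism $\varphi: X\to X$, such that $$\phi(f)(x)=b(x)\,\bigl[\tau(x)\bigr]\bigl(f(\varphi(x))\bigr)\,b(x)^*\qquad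 (f\in C(X,\mathcal B(H)),\ x\in X).$$ -/

import Mathlib

/-- An element of a star ring is positive if it is of the form `b* b`; in a C*-algebra these are
exactly the self-adjoint elements with spectrum in `[0, ∞)`. -/
def IsPositiveElem {A : Type*} [Mul A] [Star A] (a : A) : Prop :=
  ∃ b : A, a = star b * b

/-- A linear bijection `φ` of a C*-algebra (no continuity is assumed) is an order automorphism if
`φ a` is positive if and only if `a` is positive. -/
def IsOrderAutomorphism {A : Type*} [CStarAlgebra A] (φ : A ≃ₗ[ℂ] A) : Prop :=
  ∀ a : A, IsPositiveElem (φ a) ↔ IsPositiveElem a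

/-- The Jordan *-automorphisms of a complex *-algebra, as a subgroup of its linear
automorphisms. -/
def Jaut (R : Type*) [Ring R] [StarRing R] [Algebra ℂ R] : Subgroup (R ≃ₗ[ℂ] R) where
  carrier := {φ | ∀ x, φ (x ^ 2) = φ x ^ 2 ∧ φ (star x) = star (φ x)}
  one_mem' := fun _ => ⟨rfl, rfl⟩
  mul_mem' := by
    intro φ ψ hφ hψ x
    simp only [LinearEquiv.mul_apply]
    exact ⟨by rw [(hψ x).1, (hφ _).1], by rw [(hψ x).2, (hφ _).2]⟩
  inv_mem' := by
    intro φ hφ x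
    have h : ∀ y, φ (φ⁻¹ y) = y := fun y => φ.apply_symm_apply y
    constructor <;> apply φ.injective
    · rw [(hφ _).1, h, h]
    · rw [(hφ _).2, h, h]

/-- Strong (that is, pointwise norm) continuity of a family of linear automorphisms. -/
def StronglyContinuous {X R : Type*} [TopologicalSpace X] [AddCommMonoid R] [Module ℂ R]
    [TopologicalSpace R] (τ : X → (R ≃ₗ[ℂ] R)) : Prop :=
  ∀ a : R, Continuous fun x => τ x a

/-! Congruence by the square root of `φ 1`, which is invertible, reduces to a unital order
isomorphism `ψ`. By Kadison's theorem (`map_sq_of_orderIso`) `ψ` is a Jordan isomorphism, so it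
preserves the center (`map_commute_of_forall_commute`). As `B(H)` has scalar center, the center of
`C(X, B(H))` is `C(X)`, on which `ψ` is composition with some `ϕ : X → X`. The order then makes `ψ`
local: a self-adjoint `f` with `f (ϕ x) = 0` lies between `±‖f ·‖`, scalar functions vanishing at `ϕ
x`, so `ψ f x = 0`. Hence `ψ f x` depends only on `f (ϕ x)`, and this dependence is `τ x`. The same
argument for `ψ.symm` provides the inverses of `ϕ` and `τ x`. -/

theorem isPositiveElem_iff_nonneg {A : Type*} [CStarAlgebra A] [PartialOrder A]
    [StarOrderedRing A] {a : A} : IsPositiveElem a ↔ 0 ≤ a :=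
  CStarAlgebra.nonneg_iff_eq_star_mul_self.symm

/-- The spectral order is used only inside the proof, so this applies to `C(X, B)` before its
pointwise order is known to be star-ordered. -/
theorem IsSelfAdjoint.isPositiveElem_of_spectrum_nonneg {A : Type*} [CStarAlgebra A] {a : A}
    (ha : IsSelfAdjoint a) (h : ∀ t ∈ spectrum ℝ a, 0 ≤ t) : IsPositiveElem a := by
  let _ := CStarAlgebra.spectralOrder A
  have := CStarAlgebra.spectralOrderedRing A
  exact isPositiveElem_iff_nonneg.2
    ((StarOrderedRing.nonneg_iff_spectrum_nonneg (R := ℝ) a).2 h)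

/-- For the pointwise order, the positive elements of `C(X, B)` are those of the form `b* b`. -/
instance ContinuousMap.starOrderedRing_of_cstarAlgebra {X B : Type*} [TopologicalSpace X]
    [CompactSpace X] [CStarAlgebra B] [PartialOrder B] [StarOrderedRing B] :
    StarOrderedRing C(X, B) := by
  refine StarOrderedRing.of_nonneg_iff' (fun h z x => by simpa using h x) fun f => ⟨fun h => ?_, ?_⟩
  · have hsa : IsSelfAdjoint f := by
      ext1 x
      exact (IsSelfAdjoint.of_nonneg (h x : (0 : B) ≤ f x)).star_eq
    refine hsa.isPositiveElem_of_spectrum_nonneg fun t ht => ?_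
    by_contra! hlt
    -- Invertibility in `C(X, B)` is pointwise, and a negative `t` is in no spectrum of a value `f
    -- x`.
    refine ht ((ContinuousMap.isUnit_iff_forall_isUnit _).2 fun x => ?_)
    by_contra hx
    exact hlt.not_ge (spectrum_nonneg_of_nonneg (h x : (0 : B) ≤ f x) hx)
  · rintro ⟨g, rfl⟩ x
    exact star_mul_self_nonneg (g x)

/-! ### Polarization identities for squares -/

section Squares

variable {R : Type*} [Ring R]

theorem mul_add_mul_swap (a b : R) : a * b + b * a = (a + b) ^ 2 - a ^ 2 - b ^ 2 := by
  noncomm_ring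

theorem sq_smul_add_smul_one [Algebra ℂ R] (r t : ℂ) (c : R) :
    (r • c + t • (1 : R)) ^ 2 = r ^ 2 • c ^ 2 + (2 * r * t) • c + t ^ 2 • (1 : R) := by
  simp only [pow_two, add_mul, mul_add, smul_mul_assoc, mul_smul_comm, mul_one, one_mul]
  match_scalars <;> ring

theorem sq_add_I_smul [Algebra ℂ R] (a b : R) :
    (a + Complex.I • b) ^ 2 = a ^ 2 - b ^ 2 + Complex.I • (a * b + b * a) := by
  simp only [pow_two, add_mul, mul_add, smul_mul_assoc, mul_smul_comm, smul_smul,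
    Complex.I_mul_I, smul_add, neg_smul, one_smul]
  abel

end Squares

/-! ### Kadison's theorem and reduction to the unital case -/

section Kadison

variable {A B : Type*} [CStarAlgebra A] [PartialOrder A] [StarOrderedRing A]
  [CStarAlgebra B] [PartialOrder B] [StarOrderedRing B]

theorem aeval_bernsteinPolynomial_nonneg {a : A} (h0 : 0 ≤ a) (h1 : a ≤ 1) (n ν : ℕ) :
    0 ≤ Polynomial.aeval a (bernsteinPolynomial ℝ n ν) := by
  have h : Commute (a ^ ν) ((1 - a) ^ (n - ν)) :=
    ((Commute.one_right a).sub_right (Commute.refl a)).pow_pow _ _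
  have := Commute.mul_nonneg (CStarAlgebra.pow_nonneg h0 ν)
    (CStarAlgebra.pow_nonneg (sub_nonneg.2 h1) (n - ν)) h
  simp only [bernsteinPolynomial, map_mul, map_natCast, map_pow, Polynomial.aeval_X, map_sub,
    map_one]
  rw [mul_assoc, ← nsmul_eq_mul]
  exact nsmul_nonneg this _

/-- The variance of a finite positive operator-valued measure is nonnegative. -/
theorem sq_sum_smul_le_sum_sq_smul {ι : Type*} (s : Finset ι) (c : ι → ℝ) (p : ι → B)
    (hp : ∀ i ∈ s, 0 ≤ p i) (hsum : ∑ i ∈ s, p i = 1) :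
    (∑ i ∈ s, c i • p i) ^ 2 ≤ ∑ i ∈ s, c i ^ 2 • p i := by
  set S := ∑ i ∈ s, c i • p i with hS
  have hSsa : IsSelfAdjoint S := by
    refine isSelfAdjoint_sum s fun i hi => ?_
    exact (IsSelfAdjoint.all (c i)).smul (IsSelfAdjoint.of_nonneg (hp i hi))
  -- The variance as a sum of conjugates of the positive `p i`.
  have key : ∑ i ∈ s, star (c i • (1 : B) - S) * p i * (c i • (1 : B) - S) =
      (∑ i ∈ s, c i ^ 2 • p i) - S ^ 2 := by
    have h : ∀ i ∈ s, star (c i • (1 : B) - S) * p i * (c i • (1 : B) - S) =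
        c i ^ 2 • p i - S * (c i • p i) - (c i • p i) * S + S * p i * S := by
      intro i _
      simp only [star_sub, star_smul, star_one, hSsa.star_eq, star_trivial, sub_mul, mul_sub,
        smul_mul_assoc, mul_smul_comm, one_mul, mul_one, smul_smul, pow_two, smul_sub]
      abel
    rw [Finset.sum_congr rfl h, Finset.sum_add_distrib, Finset.sum_sub_distrib,
      Finset.sum_sub_distrib, ← Finset.mul_sum, ← Finset.sum_mul, ← Finset.sum_mul,
      ← Finset.mul_sum, hsum, ← hS]
    noncomm_ring
  rw [← sub_nonneg, ← key]
  exact Finset.sum_nonneg fun i hi => star_left_conjugate_nonneg (hp i hi) _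

/-- The images under `ψ` of the Bernstein polynomials in `a` form a positive operator-valued
measure; at the nodes `ν / n` its mean is `ψ a`, and the Bernstein second moment `x² + x(1 - x)/n`
gives the error term. -/
theorem map_sq_le_add_smul_of_nonneg_of_le_one (ψ : A →ₗ[ℂ] B) (hpos : ∀ a, 0 ≤ a → 0 ≤ ψ a)
    (hone : ψ 1 = 1) {a : A} (h0 : 0 ≤ a) (h1 : a ≤ 1) {n : ℕ} (hn : n ≠ 0) :
    ψ a ^ 2 ≤ ψ (a ^ 2) + (n : ℝ)⁻¹ • ψ (a - a ^ 2) := by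
  have hn' : (n : ℝ) ≠ 0 := by exact_mod_cast hn
  let P : ℕ → A := fun ν => Polynomial.aeval a (bernsteinPolynomial ℝ n ν)
  have hreal : ∀ (r : ℝ) (x : A), ψ (r • x) = r • ψ x := fun r x => by
    rw [← Complex.coe_smul, map_smul, Complex.coe_smul]
  have e0 : ∑ ν ∈ Finset.range (n + 1), P ν = 1 := by
    simpa [P] using congrArg (Polynomial.aeval a) (bernsteinPolynomial.sum ℝ n)
  have e1 : ∑ ν ∈ Finset.range (n + 1), (ν : ℝ) • P ν = (n : ℝ) • a := by
    have := congrArg (Polynomial.aeval a) (bernsteinPolynomial.sum_smul ℝ n)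
    simpa [P, Nat.cast_smul_eq_nsmul, map_nsmul] using this
  have e2 : ∑ ν ∈ Finset.range (n + 1), ((ν : ℝ) * (ν - 1)) • P ν =
      ((n : ℝ) * (n - 1)) • a ^ 2 := by
    have := congrArg (Polynomial.aeval a) (bernsteinPolynomial.sum_mul_smul ℝ n)
    have hc : ∀ k : ℕ, ((k : ℝ) * (k - 1)) = ((k * (k - 1) : ℕ) : ℝ) := by
      rintro (_ | k) <;> simp
    simp only [hc, Nat.cast_smul_eq_nsmul]
    simpa only [P, map_sum, map_nsmul, map_pow, Polynomial.aeval_X] using this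
  have e3 : ∑ ν ∈ Finset.range (n + 1), ((ν : ℝ) ^ 2) • P ν =
      ((n : ℝ) * (n - 1)) • a ^ 2 + (n : ℝ) • a := by
    rw [← e1, ← e2, ← Finset.sum_add_distrib]
    refine Finset.sum_congr rfl fun ν _ => ?_
    rw [← add_smul]
    ring_nf
  have h := sq_sum_smul_le_sum_sq_smul (Finset.range (n + 1)) (fun ν => (ν : ℝ) / n)
    (fun ν => ψ (P ν)) (fun ν _ => hpos _ (aeval_bernsteinPolynomial_nonneg h0 h1 n ν))
    (by rw [← map_sum, e0, hone])
  have l : ∑ ν ∈ Finset.range (n + 1), ((ν : ℝ) / n) • ψ (P ν) = ψ a := by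
    simp only [← hreal, ← map_sum]
    congr 1
    simp only [div_eq_inv_mul, mul_smul, ← Finset.smul_sum]
    rw [e1, smul_smul, inv_mul_cancel₀ hn', one_smul]
  have r : ∑ ν ∈ Finset.range (n + 1), ((ν : ℝ) / n) ^ 2 • ψ (P ν) =
      ψ (a ^ 2) + (n : ℝ)⁻¹ • ψ (a - a ^ 2) := by
    simp only [← hreal, ← map_sum, ← map_add]
    congr 1
    simp only [div_eq_inv_mul, mul_pow, mul_smul, ← Finset.smul_sum]
    rw [e3]
    match_scalars <;> field_simp
    ring
  rwa [l, r] at h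

/-- Kadison's inequality for positive contractions. -/
theorem map_sq_le_of_nonneg_of_le_one (ψ : A →ₗ[ℂ] B) (hpos : ∀ a, 0 ≤ a → 0 ≤ ψ a)
    (hone : ψ 1 = 1) {a : A} (h0 : 0 ≤ a) (h1 : a ≤ 1) : ψ a ^ 2 ≤ ψ (a ^ 2) := by
  have ht : Filter.Tendsto (fun n : ℕ => ψ (a ^ 2) + (n : ℝ)⁻¹ • ψ (a - a ^ 2)) Filter.atTop
      (nhds (ψ (a ^ 2) + (0 : ℝ) • ψ (a - a ^ 2))) :=
    ((tendsto_inv_atTop_nhds_zero_nat (𝕜 := ℝ)).smul_const _).const_add _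
  rw [zero_smul, add_zero] at ht
  refine ge_of_tendsto ht ?_
  filter_upwards [Filter.eventually_ne_atTop 0] with n hn
  exact map_sq_le_add_smul_of_nonneg_of_le_one ψ hpos hone h0 h1 hn

theorem IsSelfAdjoint.exists_affine_mem_unitInterval {a : A} (ha : IsSelfAdjoint a) :
    ∃ (r t : ℂ) (c : A), 0 ≤ c ∧ c ≤ 1 ∧ a = r • c + t • 1 := by
  -- The `+ 1` makes `2 * N` invertible even for `a = 0`.
  set N : ℝ := ‖a‖ + 1 with hN
  have hNpos : 0 < N := by positivity
  have hle : algebraMap ℝ A ‖a‖ ≤ algebraMap ℝ A N := by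
    rw [← sub_nonneg, ← map_sub, hN, add_sub_cancel_left, map_one]
    exact zero_le_one
  have hup : a ≤ N • (1 : A) := by
    rw [← Algebra.algebraMap_eq_smul_one]
    exact ha.le_algebraMap_norm_self.trans hle
  have hlo : -(N • (1 : A)) ≤ a := by
    rw [← Algebra.algebraMap_eq_smul_one]
    exact (neg_le_neg hle).trans ha.neg_algebraMap_norm_le_self
  refine ⟨(2 * N : ℝ), (-N : ℝ), (2 * N)⁻¹ • (a + N • (1 : A)), ?_, ?_, ?_⟩
  · exact smul_nonneg (by positivity) (by simpa using add_le_add_left hlo (N • (1 : A)))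
  · have h : (2 * N)⁻¹ • (a + N • (1 : A)) ≤ (2 * N)⁻¹ • (N • (1 : A) + N • (1 : A)) :=
      smul_le_smul_of_nonneg_left (by simpa using hup) (by positivity)
    refine h.trans_eq ?_
    match_scalars
    field_simp
    ring
  · simp only [Complex.coe_smul]
    match_scalars <;> field_simp
    ring

/-- **Kadison's theorem**: a unital order isomorphism of C*-algebras preserves squares. -/
theorem map_sq_of_orderIso (ψ : A ≃ₗ[ℂ] B) (hψ : ∀ a, 0 ≤ ψ a ↔ 0 ≤ a) (hone : ψ 1 = 1)
    (x : A) : ψ (x ^ 2) = ψ x ^ 2 := by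
  have hsymm : ∀ b, 0 ≤ b → 0 ≤ ψ.symm b := fun b hb => by rwa [← hψ, ψ.apply_symm_apply]
  have unit : ∀ c : A, 0 ≤ c → c ≤ 1 → ψ (c ^ 2) = ψ c ^ 2 := by
    intro c h0 h1
    have h0' := (hψ c).2 h0
    have h1' : ψ c ≤ 1 := by rw [← sub_nonneg, ← hone, ← map_sub, hψ]; exact sub_nonneg.2 h1
    refine le_antisymm ?_
      (map_sq_le_of_nonneg_of_le_one (ψ : A →ₗ[ℂ] B) (fun a => (hψ a).2) hone h0 h1)
    -- The inequality for `ψ.symm` at `ψ c` becomes the reverse one after applying `ψ`.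
    have := map_sq_le_of_nonneg_of_le_one (ψ.symm : B →ₗ[ℂ] A) hsymm
      (by simp [LinearEquiv.symm_apply_eq, hone]) h0' h1'
    simp only [LinearEquiv.coe_coe, ψ.symm_apply_apply] at this
    rw [← sub_nonneg, ← hψ, map_sub, ψ.apply_symm_apply, sub_nonneg] at this
    exact this
  have sa : ∀ a : A, IsSelfAdjoint a → ψ (a ^ 2) = ψ a ^ 2 := by
    intro a ha
    obtain ⟨r, t, c, h0, h1, rfl⟩ := ha.exists_affine_mem_unitInterval
    simp only [sq_smul_add_smul_one, map_add, map_smul, hone, unit c h0 h1]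
  have mix : ∀ a b : A, IsSelfAdjoint a → IsSelfAdjoint b →
      ψ (a * b + b * a) = ψ a * ψ b + ψ b * ψ a := by
    intro a b ha hb
    rw [mul_add_mul_swap, map_sub, map_sub, sa _ (ha.add hb), sa a ha, sa b hb, map_add,
      ← mul_add_mul_swap]
  rw [← realPart_add_I_smul_imaginaryPart x]
  rw [sq_add_I_smul, map_add, map_sub, map_smul, sa _ (realPart x).2, sa _ (imaginaryPart x).2,
    mix _ _ (realPart x).2 (imaginaryPart x).2, ← sq_add_I_smul, map_add,
    map_smul]

theorem map_star_of_orderIso (ψ : A ≃ₗ[ℂ] B) (hψ : ∀ a, 0 ≤ ψ a ↔ 0 ≤ a) (x : A) :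
    ψ (star x) = star (ψ x) :=
  map_star (PositiveLinearMap.mk₀ (ψ : A →ₗ[ℂ] B) fun a => (hψ a).2) x

/-- An order automorphism is a unital order automorphism followed by a positive congruence. -/
theorem exists_congr_unital_orderIso (φ : A ≃ₗ[ℂ] A) (hφ : ∀ a, 0 ≤ φ a ↔ 0 ≤ a) :
    ∃ (b : A) (ψ : A ≃ₗ[ℂ] A), 0 ≤ b ∧ IsUnit b ∧ (∀ a, 0 ≤ ψ a ↔ 0 ≤ a) ∧ ψ 1 = 1 ∧
      ∀ a, φ a = b * ψ a * star b := by
  have h1 : 0 ≤ φ 1 := (hφ 1).2 zero_le_one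
  have hu : IsUnit (φ 1) := by
    obtain ⟨u, hu⟩ := φ.surjective 1
    have hu0 : 0 ≤ u := by rw [← hφ, hu]; exact zero_le_one
    set N : ℝ := ‖u‖ + 1 with hN
    have hNpos : N ≠ 0 := by positivity
    have hle : u ≤ N • (1 : A) := by
      rw [← Algebra.algebraMap_eq_smul_one]
      refine (IsSelfAdjoint.of_nonneg hu0).le_algebraMap_norm_self.trans ?_
      rw [← sub_nonneg, ← map_sub, hN, add_sub_cancel_left, map_one]
      exact zero_le_one
    -- Apply `φ` to `u ≤ N • 1`, where `φ u = 1`: so `φ 1` is bounded below.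
    have h : 1 ≤ N • φ 1 := by
      have := (hφ _).2 (sub_nonneg.2 hle)
      rwa [← Complex.coe_smul, map_sub, map_smul, Complex.coe_smul, hu, sub_nonneg] at this
    have := CStarAlgebra.isUnit_of_le 1 h
    rw [← one_smul ℝ (φ 1), ← inv_mul_cancel₀ hNpos, mul_smul]
    exact this.smul (Units.mk0 _ (inv_ne_zero hNpos))
  set s := CFC.sqrt (φ 1) with hs
  have hss : s * s = φ 1 := CFC.sqrt_mul_sqrt_self (φ 1) h1
  have hs0 : 0 ≤ s := CFC.sqrt_nonneg _
  have hsu : IsUnit s := by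
    rw [← hss] at hu
    exact (Commute.isUnit_mul_iff (Commute.refl s)).1 hu |>.1
  obtain ⟨v, hv⟩ := hsu
  have hvs : star (v : A) = v := by rw [hv]; exact (IsSelfAdjoint.of_nonneg hs0).star_eq
  have hvi : star (↑v⁻¹ : A) = ↑v⁻¹ := by
    have h : star v = v := Units.ext hvs
    rw [← Units.coe_star_inv, h]
  let conj : A ≃ₗ[ℂ] A :=
    { toFun := fun a => ↑v⁻¹ * a * ↑v⁻¹
      invFun := fun a => v * a * v
      map_add' := fun a b => by simp [mul_add, add_mul]
      map_smul' := fun c a => by simp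
      left_inv := fun a => by simp [mul_assoc]
      right_inv := fun a => by simp [mul_assoc] }
  refine ⟨v, φ.trans conj, hv ▸ hs0, v.isUnit, fun a => ?_, ?_, fun a => ?_⟩
  · rw [← hφ a]
    refine ⟨fun h => ?_, fun h => ?_⟩
    · have := star_left_conjugate_nonneg h (v : A)
      simpa [conj, hvs, mul_assoc] using this
    · have := star_left_conjugate_nonneg h (↑v⁻¹ : A)
      rwa [hvi] at this
  · change ↑v⁻¹ * φ 1 * ↑v⁻¹ = (1 : A)
    rw [← hss, ← hv]
    simp
  · simp [conj, hvs, mul_assoc]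

end Kadison

/-! ### Jordan automorphisms and the center -/

section JordanCenter

variable {A : Type*} [CStarAlgebra A]

theorem map_mul_add_mul_swap (ψ : A ≃ₗ[ℂ] A) (hsq : ∀ x, ψ (x ^ 2) = ψ x ^ 2) (x y : A) :
    ψ (x * y + y * x) = ψ x * ψ y + ψ y * ψ x := by
  rw [mul_add_mul_swap, map_sub, map_sub, hsq, hsq, hsq, map_add, ← mul_add_mul_swap]

theorem map_bracket_bracket (ψ : A ≃ₗ[ℂ] A) (hsq : ∀ x, ψ (x ^ 2) = ψ x ^ 2) (x y z : A) :
    ψ ⁅y, ⁅x, z⁆⁆ = ⁅ψ y, ⁅ψ x, ψ z⁆⁆ := by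
  -- The double commutator is the associator of the anticommutator product.
  have e : ∀ x y z : A, ⁅y, ⁅x, z⁆⁆ = ((x * y + y * x) * z + z * (x * y + y * x)) -
      (x * (y * z + z * y) + (y * z + z * y) * x) := by
    intro x y z
    simp only [Ring.lie_def]
    noncomm_ring
  rw [e, e, map_sub]
  simp only [map_mul_add_mul_swap ψ hsq]

theorem eq_zero_of_sq_eq_zero_of_commute {c : A} (hc : ∀ y, Commute c y) (h : c ^ 2 = 0) :
    c = 0 := by
  rw [← CStarRing.star_mul_self_eq_zero_iff, ← CStarRing.star_mul_self_eq_zero_iff]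
  rw [star_mul, star_star, mul_assoc, ← mul_assoc c, (hc (star c)).eq, mul_assoc (star c),
    ← pow_two, h, mul_zero, mul_zero]

/-- Since `⁅y * w, w⁆ = ⁅y, w⁆ * w` commutes with `y`, the Leibniz rule forces `⁅y, w⁆ ^ 2 = 0`; a
central element of square zero in a C*-algebra vanishes. -/
theorem commute_of_bracket_commute {w : A} (hw : ∀ y v : A, Commute v ⁅y, w⁆) (y : A) :
    Commute y w := by
  rw [commute_iff_lie_eq]
  refine eq_zero_of_sq_eq_zero_of_commute (fun v => (hw y v).symm) ?_
  have h := hw (y * w) y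
  have e : ⁅y * w, w⁆ = ⁅y, w⁆ * w := by simp only [Ring.lie_def]; noncomm_ring
  rw [e, commute_iff_lie_eq] at h
  have h' := (hw y y).eq
  have e' : ⁅y, ⁅y, w⁆ * w⁆ = ⁅y, w⁆ ^ 2 + (y * ⁅y, w⁆ - ⁅y, w⁆ * y) * w := by
    simp only [Ring.lie_def]; noncomm_ring
  rwa [e', h', sub_self, zero_mul, add_zero] at h

/-- A Jordan automorphism of a C*-algebra maps the center into itself. -/
theorem map_commute_of_forall_commute (ψ : A ≃ₗ[ℂ] A) (hsq : ∀ x, ψ (x ^ 2) = ψ x ^ 2)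
    {z : A} (hz : ∀ y, Commute y z) (y : A) :
    Commute y (ψ z) := by
  refine commute_of_bracket_commute (fun y v => ?_) y
  obtain ⟨y, rfl⟩ := ψ.surjective y
  obtain ⟨v, rfl⟩ := ψ.surjective v
  rw [commute_iff_lie_eq, ← map_bracket_bracket ψ hsq, (hz y).lie_eq,
    (Commute.zero_right v).lie_eq, map_zero]

theorem map_mul_of_forall_commute (ψ : A ≃ₗ[ℂ] A) (hsq : ∀ x, ψ (x ^ 2) = ψ x ^ 2)
    {z : A} (hz : ∀ y, Commute y z) (y : A) :
    ψ (z * y) = ψ z * ψ y := by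
  have h := map_mul_add_mul_swap ψ hsq z y
  rw [(hz y).eq, (map_commute_of_forall_commute ψ hsq hz (ψ y)).eq, map_add, ← two_smul ℂ,
    ← two_smul ℂ (ψ z * ψ y)] at h
  exact smul_right_injective A two_ne_zero h

end JordanCenter

/-! ### Locality and the fibre maps on `C(X, B)` -/

section ContinuousFunctions

variable {X B : Type*} [TopologicalSpace X] [CStarAlgebra B]

theorem smul_one_commute (g : C(X, ℂ)) (f : C(X, B)) : Commute f (g • (1 : C(X, B))) := by
  ext1 x
  simp

theorem exists_smul_one_of_forall_commute [Nontrivial B] [Algebra.IsCentral ℂ B] {w : C(X, B)}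
    (hw : ∀ f, Commute f w) : ∃ g : C(X, ℂ), w = g • (1 : C(X, B)) := by
  have h : ∀ x, ∃ c : ℂ, algebraMap ℂ B c = w x := fun x => by
    have hx : w x ∈ Subalgebra.center ℂ B := Subalgebra.mem_center_iff.2 fun b =>
      DFunLike.congr_fun (hw (ContinuousMap.const X b)).eq x
    rwa [Algebra.IsCentral.center_eq_bot, Algebra.mem_bot] at hx
  choose c hc using h
  -- The scalars embed isometrically in `B`, so `c` inherits continuity from `w`.
  refine ⟨⟨c, (algebraMap_isometry ℂ B).isEmbedding.continuous_iff.2 ?_⟩, ?_⟩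
  · convert w.continuous using 1
    exact funext hc
  · ext1 x
    simp [← hc, Algebra.algebraMap_eq_smul_one]

theorem smul_one_injective [Nontrivial B] :
    Function.Injective fun g : C(X, ℂ) => g • (1 : C(X, B)) := by
  intro g g' h
  ext1 x
  have := DFunLike.congr_fun h x
  exact smul_left_injective ℂ (one_ne_zero : (1 : B) ≠ 0) (by simpa using this)

/-- A unital *-endomorphism of `C(X)` is composition with a continuous map. -/
theorem exists_forall_eq_comp [CompactSpace X] [T2Space X] (α : C(X, ℂ) →⋆ₐ[ℂ] C(X, ℂ)) :
    ∃ ϕ : C(X, X), ∀ g, α g = g.comp ϕ := by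
  let e := WeakDual.CharacterSpace.homeoEval X ℂ
  refine ⟨(e.symm : C(_, _)).comp ((WeakDual.CharacterSpace.compContinuousMap α).comp
    (e : C(_, _))), fun g => ?_⟩
  ext1 x
  have h : e (e.symm (WeakDual.CharacterSpace.compContinuousMap α (e x))) g =
      WeakDual.CharacterSpace.compContinuousMap α (e x) g := by rw [e.apply_symm_apply]
  exact h.symm

/-- A unital Jordan *-automorphism of `C(X, B)`, with `B` central, acts on the center `C(X)` by
composition with a continuous map. -/
theorem exists_map_smul_one_eq_comp [CompactSpace X] [T2Space X] [Nontrivial B]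
    [Algebra.IsCentral ℂ B]
    (ψ : C(X, B) ≃ₗ[ℂ] C(X, B)) (hsq : ∀ f, ψ (f ^ 2) = ψ f ^ 2)
    (hstar : ∀ f, ψ (star f) = star (ψ f)) (hone : ψ 1 = 1) :
    ∃ ϕ : C(X, X), ∀ g : C(X, ℂ), ψ (g • (1 : C(X, B))) = g.comp ϕ • (1 : C(X, B)) := by
  choose α hα using fun g : C(X, ℂ) => exists_smul_one_of_forall_commute
    (map_commute_of_forall_commute ψ hsq (smul_one_commute (B := B) g))
  have inj := smul_one_injective (X := X) (B := B)
  have hαone : α 1 = 1 := inj <| by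
    change α 1 • (1 : C(X, B)) = (1 : C(X, ℂ)) • 1
    rw [← hα, one_smul, hone]
  have hsmul : ∀ (c : ℂ) (g : C(X, ℂ)), α (c • g) = c • α g := fun c g => inj <| by
    change α (c • g) • (1 : C(X, B)) = (c • α g) • (1 : C(X, B))
    have e : ∀ g : C(X, ℂ), (c • g) • (1 : C(X, B)) = c • g • (1 : C(X, B)) := fun g => by
      ext1 x; simp [mul_smul]
    rw [← hα, e, map_smul, hα, e]
  let α' : C(X, ℂ) →⋆ₐ[ℂ] C(X, ℂ) :=
    { toFun := α
      map_one' := hαone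
      map_mul' := fun g h => inj <| by
        change α (g * h) • (1 : C(X, B)) = (α g * α h) • (1 : C(X, B))
        have e : ∀ g h : C(X, ℂ), (g * h) • (1 : C(X, B)) = (g • 1) * (h • 1) := fun g h => by
          ext1 x; simp [smul_smul, mul_comm]
        rw [← hα, e, map_mul_of_forall_commute ψ hsq (smul_one_commute g), hα, hα, e]
      map_zero' := by simpa using hsmul 0 0
      map_add' := fun g h => inj <| by
        change α (g + h) • (1 : C(X, B)) = (α g + α h) • (1 : C(X, B))
        rw [← hα, add_smul, map_add, hα, hα, add_smul]
      commutes' := fun c => by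
        rw [Algebra.algebraMap_eq_smul_one, hsmul, hαone]
      map_star' := fun g => inj <| by
        change α (star g) • (1 : C(X, B)) = star (α g) • (1 : C(X, B))
        have e : ∀ g : C(X, ℂ), star g • (1 : C(X, B)) = star (g • (1 : C(X, B))) := fun g => by
          ext1 x; simp
        rw [← hα, e, hstar, hα, e] }
  obtain ⟨ϕ, hϕ⟩ := exists_forall_eq_comp α'
  exact ⟨ϕ, fun g => by rw [hα, ← hϕ g]; rfl⟩

theorem exists_unital_orderIso_apply_eq [CompactSpace X] [T2Space X] [Nontrivial B]
    [Algebra.IsCentral ℂ B]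
    [PartialOrder B] [StarOrderedRing B]
    (ψ : C(X, B) ≃ₗ[ℂ] C(X, B)) (hψ : ∀ f, 0 ≤ ψ f ↔ 0 ≤ f) (hone : ψ 1 = 1) :
    ∃ ϕ : C(X, X), (∀ g : C(X, ℂ), ψ (g • (1 : C(X, B))) = g.comp ϕ • (1 : C(X, B))) ∧
      ∀ f x, ψ f x = ψ (ContinuousMap.const X (f (ϕ x))) x := by
  have hstar := map_star_of_orderIso ψ hψ
  obtain ⟨ϕ, hϕ⟩ := exists_map_smul_one_eq_comp ψ (map_sq_of_orderIso ψ hψ hone) hstar hone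
  have upper : ∀ f x, IsSelfAdjoint f → f (ϕ x) = 0 → ψ f x ≤ 0 := by
    intro f x hf h0
    let n : C(X, ℂ) := ⟨fun y => (‖f y‖ : ℂ), by fun_prop⟩
    have hle : f ≤ n • (1 : C(X, B)) := fun y => by
      have hy : IsSelfAdjoint (f y) := DFunLike.congr_fun hf.star_eq y
      have := hy.le_algebraMap_norm_self
      rw [Algebra.algebraMap_eq_smul_one, ← Complex.coe_smul] at this
      simpa [n] using this
    have h := (hψ _).2 (sub_nonneg.2 hle)
    rw [map_sub, sub_nonneg, hϕ] at h
    simpa [n, h0] using h x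
  have sa : ∀ f x, IsSelfAdjoint f → f (ϕ x) = 0 → ψ f x = 0 := fun f x hf h0 =>
    le_antisymm (upper f x hf h0) (by simpa using upper (-f) x hf.neg (by simpa using h0))
  have zero : ∀ f x, f (ϕ x) = 0 → ψ f x = 0 := by
    intro f x h0
    have hr := sa (realPart f) x (realPart f).2 (by simp [realPart_apply_coe, h0])
    have hi := sa (imaginaryPart f) x (imaginaryPart f).2 (by simp [imaginaryPart_apply_coe, h0])
    rw [← realPart_add_I_smul_imaginaryPart f, map_add, map_smul]
    simp [hr, hi]
  refine ⟨ϕ, hϕ, fun f x => sub_eq_zero.1 ?_⟩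
  have := zero (f - ContinuousMap.const X (f (ϕ x))) x (by simp)
  simpa using this

/-- Continuous scalar functions separate the points of `X`. -/
theorem comp_eq_id_of_map_smul_one [CompactSpace X] [T2Space X] [Nontrivial B]
    (ψ : C(X, B) ≃ₗ[ℂ] C(X, B))
    {ϕ ϕ' : C(X, X)} (h : ∀ g : C(X, ℂ), ψ (g • (1 : C(X, B))) = g.comp ϕ • (1 : C(X, B)))
    (h' : ∀ g : C(X, ℂ), ψ.symm (g • (1 : C(X, B))) = g.comp ϕ' • (1 : C(X, B))) (x : X) :
    ϕ (ϕ' x) = x := by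
  have key : ∀ g : C(X, ℂ), g (ϕ (ϕ' x)) = g x := fun g => by
    have e := h' (g.comp ϕ)
    rw [← h g, ψ.symm_apply_apply] at e
    exact (DFunLike.congr_fun (smul_one_injective e) x).symm
  refine (WeakDual.CharacterSpace.homeoEval X ℂ).injective ?_
  ext g
  exact key g

/-- The structure of unital order automorphisms of `C(X, B)` for a central C*-algebra `B`. -/
theorem exists_jaut_homeomorph [CompactSpace X] [T2Space X] [Nontrivial B] [Algebra.IsCentral ℂ B]
    [PartialOrder B] [StarOrderedRing B]
    (ψ : C(X, B) ≃ₗ[ℂ] C(X, B)) (hψ : ∀ f, 0 ≤ ψ f ↔ 0 ≤ f) (hone : ψ 1 = 1) :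
    ∃ (τ : X → Jaut B) (ϕ : X ≃ₜ X), StronglyContinuous (fun x => (τ x : B ≃ₗ[ℂ] B)) ∧
      StronglyContinuous (fun x => ((τ x)⁻¹ : Jaut B).1) ∧
      ∀ f x, ψ f x = (τ x).1 (f (ϕ x)) := by
  have hψ' : ∀ f, 0 ≤ ψ.symm f ↔ 0 ≤ f := fun f => by rw [← hψ, ψ.apply_symm_apply]
  have hone' : ψ.symm 1 = 1 := by rw [LinearEquiv.symm_apply_eq, hone]
  obtain ⟨ϕ, hϕ, hloc⟩ := exists_unital_orderIso_apply_eq ψ hψ hone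
  obtain ⟨ϕ', hϕ', hloc'⟩ := exists_unital_orderIso_apply_eq ψ.symm hψ' hone'
  have hr := comp_eq_id_of_map_smul_one ψ hϕ hϕ'
  have hl := comp_eq_id_of_map_smul_one ψ.symm hϕ' hϕ
  let τ : X → B ≃ₗ[ℂ] B := fun x =>
    { toFun := fun b => ψ (ContinuousMap.const X b) x
      -- Evaluation at `ϕ x`, because `ψ.symm` is local along `ϕ'` and `ϕ' (ϕ x) = x`.
      invFun := fun b => ψ.symm (ContinuousMap.const X b) (ϕ x)
      map_add' := fun a b => by
        rw [← ContinuousMap.add_apply, ← map_add]; rfl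
      map_smul' := fun c b => by
        rw [RingHom.id_apply, ← ContinuousMap.smul_apply, ← map_smul]; rfl
      left_inv := fun b => by
        have := hloc' (ψ (ContinuousMap.const X b)) (ϕ x)
        rw [hl, ψ.symm_apply_apply] at this
        exact this.symm
      right_inv := fun b => by
        have := hloc (ψ.symm (ContinuousMap.const X b)) x
        rw [ψ.apply_symm_apply] at this
        exact this.symm }
  have hτ : ∀ x, τ x ∈ Jaut B := fun x b =>
    ⟨DFunLike.congr_fun (map_sq_of_orderIso ψ hψ hone (ContinuousMap.const X b)) x,
      DFunLike.congr_fun (map_star_of_orderIso ψ hψ (ContinuousMap.const X b)) x⟩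
  refine ⟨fun x => ⟨τ x, hτ x⟩, ⟨⟨ϕ, ϕ', hl, hr⟩, ϕ.continuous, ϕ'.continuous⟩, fun b => ?_,
    fun b => ?_, hloc⟩
  · exact (ψ (ContinuousMap.const X b)).continuous
  · exact (ψ.symm (ContinuousMap.const X b)).continuous.comp ϕ.continuous

end ContinuousFunctions

theorem theorem1 {X H : Type*} [TopologicalSpace X] [CompactSpace X] [T2Space X]
    [NormedAddCommGroup H] [InnerProductSpace ℂ H] [CompleteSpace H]
    [TopologicalSpace.SeparableSpace H]
    (φ : C(X, H →L[ℂ] H) ≃ₗ[ℂ] C(X, H →L[ℂ] H)) (hφ : IsOrderAutomorphism φ) :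
    ∃ (b : C(X, H →L[ℂ] H)) (τ : X → Jaut (H →L[ℂ] H)) (ϕ : X ≃ₜ X),
      (∀ x, (b x).IsPositive ∧ IsUnit (b x)) ∧
      StronglyContinuous (fun x => (τ x : (H →L[ℂ] H) ≃ₗ[ℂ] (H →L[ℂ] H))) ∧
      StronglyContinuous (fun x => ((τ x)⁻¹ : Jaut (H →L[ℂ] H)).1) ∧
      ∀ (f : C(X, H →L[ℂ] H)) (x : X),
        φ f x = b x * (τ x).1 (f (ϕ x)) * star (b x) := by
  obtain ⟨b, ψ, hb, hbu, hψ, hone, hφψ⟩ := exists_congr_unital_orderIso φ fun f => by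
    rw [← isPositiveElem_iff_nonneg, ← isPositiveElem_iff_nonneg, hφ]
  have hb' : ∀ x, (b x).IsPositive ∧ IsUnit (b x) := fun x =>
    ⟨(ContinuousLinearMap.nonneg_iff_isPositive _).1 (hb x),
      (ContinuousMap.isUnit_iff_forall_isUnit b).1 hbu x⟩
  cases subsingleton_or_nontrivial H with
  -- For `H = 0` scalars do not embed in the operator algebra, but all functions coincide.
  | inl h =>
    exact ⟨b, 1, Homeomorph.refl X, hb', fun _ => continuous_of_const fun _ _ => rfl,
      fun _ => continuous_of_const fun _ _ => rfl, fun _ _ => Subsingleton.elim _ _⟩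
  | inr h =>
    obtain ⟨τ, ϕ, h1, h2, h3⟩ := exists_jaut_homeomorph ψ hψ hone
    exact ⟨b, τ, ϕ, hb', h1, h2, fun f x => by rw [hφψ, ← h3]; rfl⟩
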